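/- Let $K$ be a field, $m,n\ge 0$ integers, $i\ge 0$ an integer, and let $\Delta$ be a simplicial complex (a family of subsets closed under taking subsets) on the vertex set $V\sqcup W$, where $V=\{v_1,\dots,v_m\}$ and $W=\{w_1,\dots,w_n\}$. Let $K[\Delta]=K[X_1,\dots,X_m,Y_1,\dots,Y_n]/I_\Delta$ be its Stanley–Reisner ring, where $I_\Delta$ is generated by the squarefree monomials $\prod_{v_i\in A}X_i\prod_{w_j\in A}Y_j$ of the non-faces $A\notin\Delta$; thus $I_\Delta$ is an arbitrary squarefree monomial ideal. Write $x_i,y_j$ for the residue classes of $X_i,Y_j$, and let $P=(y_1,\dots,y_n)\subset K[\Delta]$. Let $\Delta_W=\{F\in\Delta : F\subseteq W\}$, considered as a simplicial complex on $W$, let $K[\Delta_W]$ be its Stanley–Reisner ring (a quotient of $K[Y_1,\dots,Y_n]$), and let $\mathfrak m=(y_1,\dots,y_n)\subset K[\Delta_W]$. The local cohomology modules $H^i_P(K[\Delta])$ and $H^i_{\mathfrak m}(K[\Delta_W])$ are the cohomology modules of the Čech complexes on $y_1,\dots,y_n$, with the induced fine gradings by $\mathbb Z^m\times\mathbb Z^n$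 and by $\mathbb Z^n$. All their graded components are finite-dimensional over $K$, and their Hilbert series $$H_{H^i_P(K[\Delta])}(\mathbf s,\mathbf t)=\sum_{a\in\mathbb Z^m,\,b\in\mathbb Z^n}\dim_K H^i_P(K[\Delta])_{(a,b)}\,\mathbf s^a\mathbf t^b,\qquad H_{H^i_{\mathfrak m}(K[\Delta_W])}(\mathbf t)=\sum_{b\in\mathbb Z^n}\dim_K H^i_{\mathfrak m}(K[\Delta_W])_b\,\mathbf t^b$$ satisfy $$H_{H^i_P(K[\Delta])}(\mathbf s,\mathbf t)=H_{H^i_{\mathfrak m}(K[\Delta_W])}(\mathbf t)+\sum_{F\in\Delta_W}\ \sum_{\emptyset\ne G\subseteq V} d(i,F,G)\prod_{v_k\in G}\frac{s_k}{1-s_k}\prod_{w_j\in F}\frac{t_j^{-1}}{1-t_j^{-1}},$$ where $$d(i,F,G)=\dim_K\widetilde H_{i-|F|-1}\big((\operatorname{lk}_\Delta(F\cup G))_W;K\big).$$ Here $\operatorname{lk}_\Delta A=\{B : A\cup B\in\Delta,\ A\cap B=\emptyset\}$ (which has no face at all if $A\notin\Delta$), the subscript $W$ denotes the subcomplex of all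 faces contained in $W$, $\widetilde H_k(-;K)$ is reduced simplicial homology (the homology of the augmented oriented chain complex, zero for a complex without faces), and the fractions stand for the power series $\sum_{k\ge1}s^k$ and $\sum_{k\ge1}t^{-k}$; the equation is one between formal series. -/

import Mathlib

set_option maxSynthPendingDepth 3

noncomputable section

namespace StanleyReisner

/-! ### Simplicial complexes

A simplicial complex on the vertex set `σ` is a family of finite subsets of `σ` closed under
taking subsets, that is, a lower set of `Finset σ`.  The empty set is a face unless the complex is
void (has no face at all); the link of a non-face is void. -/

/-- The finite set of faces of a complex on a finite vertex set. -/
def faces {σ : Type*} [Fintype σ] (Δ : LowerSet (Finset σ)) : Finset (Finset σ) := by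
  classical exact Finset.univ.filter fun F => F ∈ Δ

/-- The link of `A` in `Δ`: all `B` disjoint from `A` such that `A ∪ B` is a face. -/
def link {σ : Type*} [DecidableEq σ] (Δ : LowerSet (Finset σ)) (A : Finset σ) :
    LowerSet (Finset σ) where
  carrier := {B | A ∪ B ∈ Δ ∧ Disjoint A B}
  lower' := fun _ _ hCB hB =>
    ⟨Δ.lower (Finset.union_subset_union_right hCB) hB.1, hB.2.mono_right hCB⟩

/-- The restriction `Δ_W` to `W` of a complex `Δ` on the disjoint union of `V` and `W`, as a
complex on the vertex set `W`. -/
def restrictRight {V W : Type*} (Δ : LowerSet (Finset (V ⊕ W))) : LowerSet (Finset W) where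
  carrier := {F | F.map Function.Embedding.inr ∈ Δ}
  lower' := fun _ _ hCB hB => Δ.lower (Finset.map_subset_map.2 hCB) hB

/-! ### Reduced simplicial homology

Faces are oriented by the linear order of the vertices; the `k`-chains of `Δ` have as basis the
faces with `k + 1` elements, for every integer `k` (so the empty face spans the `(-1)`-chains). -/

section Homology

variable (K : Type*) [Field K] {σ : Type*} [LinearOrder σ]

/-- The boundary map: `[v₀, …, vₖ] ↦ ∑ⱼ (-1) ^ j [v₀, …, v̂ⱼ, …, vₖ]` for `v₀ < ⋯ < vₖ`. -/
def boundary : (Finset σ →₀ K) →ₗ[K] (Finset σ →₀ K) :=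
  Finsupp.linearCombination K fun F : Finset σ =>
    ∑ v ∈ F, Finsupp.single (F.erase v) ((-1 : K) ^ (F.filter fun u => u < v).card)

/-- The augmented oriented chains of degree `k` of `Δ` with coefficients in `K`. -/
def chains (Δ : LowerSet (Finset σ)) (k : ℤ) : Submodule K (Finset σ →₀ K) :=
  Finsupp.supported K K {F | F ∈ Δ ∧ (F.card : ℤ) = k + 1}

/-- The cycles of degree `k`. -/
def cycles (Δ : LowerSet (Finset σ)) (k : ℤ) : Submodule K (Finset σ →₀ K) :=
  chains K Δ k ⊓ LinearMap.ker (boundary K)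

/-- The reduced simplicial homology `H̃ₖ(Δ; K)`. -/
abbrev ReducedHomology (Δ : LowerSet (Finset σ)) (k : ℤ) : Type _ :=
  cycles K Δ k ⧸ ((chains K Δ (k + 1)).map (boundary K)).submoduleOf (cycles K Δ k)

end Homology

/-! ### Čech complex and local cohomology

For a family `y` of elements of a (Noetherian) ring `R`, the local cohomology of `R` with respect
to the ideal generated by `y` is the cohomology of the Čech complex
`0 → R → ⨁ R_{yⱼ} → ⨁ R_{yⱼ yₖ} → ⋯`. -/

section Cech

variable {R : Type*} [CommRing R] {ι : Type*} (y : ι → R)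

/-- The localization `R_{y_F}`, `y_F` the product of the `y j` with `j ∈ F`. -/
abbrev CechTerm (F : Finset ι) : Type _ := Localization.Away (∏ j ∈ F, y j)

/-- The natural map `R_{y_F} → R_{y_F'}` for `F ⊆ F'`. -/
def cechMap {F F' : Finset ι} (h : F ⊆ F') : CechTerm y F →ₐ[R] CechTerm y F' :=
  IsLocalization.liftAlgHom (M := Submonoid.powers (∏ j ∈ F, y j))
    (f := Algebra.ofId R (CechTerm y F')) <| by
      rintro ⟨_, l, rfl⟩
      have hu : IsUnit (algebraMap R (CechTerm y F') (∏ j ∈ F, y j)) :=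
        isUnit_of_dvd_unit (map_dvd _ (Finset.prod_dvd_prod_of_subset F F' y h))
          (IsLocalization.Away.algebraMap_isUnit (∏ j ∈ F', y j))
      simpa [Algebra.ofId_apply] using hu.pow l

variable [LinearOrder ι]

/-- The Čech differential on the sum of all `R_{y_F}`; the component from `F' \ {j}` to `F'` is
`(-1) ^ (s - 1)` times the natural map, where `j` is the `s`-th element of `F'`. -/
def cechD : (∀ F : Finset ι, CechTerm y F) →ₗ[R] (∀ F : Finset ι, CechTerm y F) :=
  LinearMap.pi fun F' =>
    ∑ j ∈ F', ((-1 : R) ^ (F'.filter fun k => k < j).card) •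
      ((cechMap y (F'.erase_subset j)).toLinearMap ∘ₗ LinearMap.proj (F'.erase j))

/-- The Čech cochains of degree `t`: families supported on the `F` with `t` elements. -/
def cechCochains (t : ℤ) : Submodule R (∀ F : Finset ι, CechTerm y F) where
  carrier := {x | ∀ F, (F.card : ℤ) ≠ t → x F = 0}
  add_mem' := fun ha hb F hF => by simp [ha F hF, hb F hF]
  zero_mem' := fun _ _ => rfl
  smul_mem' := fun r _ ha F hF => by simp [ha F hF]

/-- The Čech cocycles of degree `t`. -/
def cechCocycles (t : ℤ) : Submodule R (∀ F : Finset ι, CechTerm y F) :=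
  cechCochains y t ⊓ LinearMap.ker (cechD y)

/-- The local cohomology of `R` in degree `t` with respect to the ideal generated by `y`. -/
abbrev LocalCohomology (t : ℤ) : Type _ :=
  cechCocycles y t ⧸ ((cechCochains y (t - 1)).map (cechD y)).submoduleOf (cechCocycles y t)

end Cech

/-! ### Stanley-Reisner rings and the fine grading -/

section Ring

variable (K : Type*) [Field K] {σ : Type*}

/-- The ideal generated by the squarefree monomials of the non-faces. -/
def stanleyReisnerIdeal (Δ : LowerSet (Finset σ)) : Ideal (MvPolynomial σ K) :=
  Ideal.span {p | ∃ F : Finset σ, F ∉ Δ ∧ p = ∏ s ∈ F, MvPolynomial.X s}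

/-- The Stanley-Reisner ring `K[Δ]`. -/
abbrev StanleyReisnerRing (Δ : LowerSet (Finset σ)) : Type _ :=
  MvPolynomial σ K ⧸ stanleyReisnerIdeal K Δ

/-- The residue classes in `K[Δ]` of the variables `X (w j)`. -/
def vars (Δ : LowerSet (Finset σ)) {ι : Type*} (w : ι → σ) (j : ι) : StanleyReisnerRing K Δ :=
  Ideal.Quotient.mk (stanleyReisnerIdeal K Δ) (MvPolynomial.X (w j))

variable [DecidableEq σ] (Δ : LowerSet (Finset σ)) {ι : Type*} (w : ι ↪ σ)

/-- The component of degree `c ∈ ℤ^σ` of `K[Δ]_{y_F}`: the `K`-span of the fractions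
`x^e / y_F^l` with `e - l • deg y_F = c`. -/
def cechTermDegree (F : Finset ι) (c : σ → ℤ) : Submodule K (CechTerm (vars K Δ w) F) :=
  Submodule.span K {z | ∃ (e : σ →₀ ℕ) (l : ℕ),
    (∀ s, (e s : ℤ) - l * (if s ∈ F.map w then 1 else 0) = c s) ∧
    z = Localization.mk
      (Ideal.Quotient.mk (stanleyReisnerIdeal K Δ) (MvPolynomial.monomial e 1))
      (⟨(∏ j ∈ F, vars K Δ w j) ^ l, l, rfl⟩ : Submonoid.powers (∏ j ∈ F, vars K Δ w j))}

variable [LinearOrder ι]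

/-- The component of degree `c ∈ ℤ^σ` of the local cohomology of `K[Δ]` with respect to the ideal
generated by the variables `w j`: the classes of the cocycles that are homogeneous of degree `c`. -/
def localCohomologyDegree (t : ℤ) (c : σ → ℤ) :
    Submodule K (LocalCohomology (vars K Δ w) t) :=
  ((Submodule.pi Set.univ fun F => cechTermDegree K Δ w F c).comap
    ((cechCocycles (vars K Δ w) t).subtype.restrictScalars K)).map
      ((((cechCochains (vars K Δ w) (t - 1)).map (cechD (vars K Δ w))).submoduleOf
        (cechCocycles (vars K Δ w) t)).mkQ.restrictScalars K)

/-- The `ℤ^σ`-graded Hilbert series of the local cohomology: the formal series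
`∑ dim_K (H^t)_c · x^c`, given by its coefficients. -/
def hilbertSeries (t : ℤ) : (σ → ℤ) → ℚ :=
  fun c => (Module.finrank K (localCohomologyDegree K Δ w t c) : ℚ)

end Ring

/-! ### Formal series in `s₁, …, sₘ, t₁, …, tₙ` and their inverses

Such a series is given by its coefficient function on `ℤ^m × ℤ^n = ℤ^(m + n)`. -/

section Series

variable {m n : ℕ}

/-- The series obtained from a power series by substituting `s i` for the variable `inl i` and
`(t j)⁻¹` for the variable `inr j`. -/
def expand (f : MvPowerSeries (Fin m ⊕ Fin n) ℚ) : (Fin m ⊕ Fin n → ℤ) → ℚ :=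
  fun c =>
    if (∀ i, 0 ≤ c (Sum.inl i)) ∧ ∀ j, c (Sum.inr j) ≤ 0 then
      MvPowerSeries.coeff (Finsupp.equivFunOnFinite.symm fun k => (c k).natAbs) f
    else 0

/-- A series in the `t j` alone, viewed as a series in all the `s i` and `t j`. -/
def ofT (m : ℕ) (f : (Fin n → ℤ) → ℚ) : (Fin m ⊕ Fin n → ℤ) → ℚ :=
  fun c => if ∀ i, c (Sum.inl i) = 0 then f fun j => c (Sum.inr j) else 0

/-- The power series of `X k / (1 - X k)`, which is `X k + (X k) ^ 2 + (X k) ^ 3 + ⋯`. -/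
def geom (k : Fin m ⊕ Fin n) : MvPowerSeries (Fin m ⊕ Fin n) ℚ :=
  MvPowerSeries.X k * (1 - MvPowerSeries.X k)⁻¹

end Series

/-- The number `d(i, F, G)`, the dimension of `H̃` of `(lk (F ∪ G))_W` in degree `i - |F| - 1`. -/
def linkDim (K : Type*) [Field K] {m n : ℕ} (Δ : LowerSet (Finset (Fin m ⊕ Fin n))) (i : ℕ)
    (F : Finset (Fin n)) (G : Finset (Fin m)) : ℕ :=
  Module.finrank K
    (ReducedHomology K (restrictRight (link Δ (G.disjSum F))) ((i : ℤ) - F.card - 1))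

end StanleyReisner

end

/-!
Everything happens one fine degree `c ∈ ℤ^σ` at a time. The localization `K[Δ]_{y_F}` is spanned by
the monomial fractions `x^e / y_F^l`, and each of them is determined by its degree
(`frac_eq_frac`), so in degree `c` it has dimension at most one. The dimension is one exactly if `c`
is nonnegative outside of `w(F)` and the union of `w(F)` with the support of `c` is a face
(`gen_ne_zero_iff`).

Let `N` be the set of the indices `j` with `c (w j) < 0`. If `c` is negative at some vertex that is
not of the form `w j`, then the Čech complex vanishes in degree `c`. Otherwise its nonzero terms are
those of the sets `N ∪ B`, where `B` runs through the faces of a simplicial complex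
`degreeComplex w c Δ` on the set of indices, and up to signs the Čech differential is the transpose of the simplicial
boundary map (`cechD_toCech`). Since a matrix and its transpose have the same rank, the component of
degree `c` of the `t`-th local cohomology has the dimension of the reduced homology of this complex
in degree `t - |N| - 1` (`finrank_localCohomologyDegree`). That homogeneous coboundaries come from
homogeneous cochains is seen from the fine grading of the localizations, which is encoded as a
coaction `K[Δ]_{y_F} → K[Δ]_{y_F}[T^±]` of the group algebra of `ℤ^σ` (`coact`).

It remains to identify the complex in degree `c = (a, b)`:
* for `a = 0` it is the same for `Δ` as for `Δ_W`, whence the first summand of the formula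
  (`degreeComplex_inr_of_eq_zero`);
* if `a` has a negative entry, it is void (`degreeComplex_eq_bot`);
* if `b` has a positive entry, it is a cone, hence acyclic (`insert_mem_degreeComplex`);
* if `a ≥ 0` and `b ≤ 0` have the supports `G` and `F`, it is the restriction to `W` of the link of
  `F ∪ G` (`degreeComplex_inr_eq_link`).
As the product of the `X_k / (1 - X_k)`, `k ∈ T`, is the sum of all monomials with support `T`
(`coeff_prod_geom`), the cases with `a ≠ 0` give the second summand.
-/

namespace StanleyReisner

noncomputable section

/-! ### Signs and the boundary map -/

section Chains

variable (K : Type*) [Field K] {σ : Type*}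

lemma single_mem_chains {Δ : LowerSet (Finset σ)} {k : ℤ} {F : Finset σ} (hF : F ∈ Δ)
    (hk : (F.card : ℤ) = k + 1) (a : K) : Finsupp.single F a ∈ chains K Δ k :=
  Finsupp.single_mem_supported K a ⟨hF, hk⟩

/-- The chains are spanned by the faces. -/
lemma chains_le_iff {Δ : LowerSet (Finset σ)} {k : ℤ} {U : Submodule K (Finset σ →₀ K)} :
    chains K Δ k ≤ U ↔ ∀ F ∈ Δ, (F.card : ℤ) = k + 1 → Finsupp.single F 1 ∈ U := by
  rw [chains, Finsupp.supported_eq_span_single, Submodule.span_le]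
  constructor
  · intro h F hF hk
    exact h ⟨F, ⟨hF, hk⟩, rfl⟩
  · rintro h _ ⟨F, ⟨hF, hk⟩, rfl⟩
    exact h F hF hk

end Chains

section Homology

variable (K : Type*) [Field K] {σ : Type*} [LinearOrder σ]

/-- The sign `(-1) ^ #{u ∈ F | u < v}` with which `v` enters the boundary of `F` and the Čech
differential into the term of `F`. -/
def sgn (v : σ) (F : Finset σ) : K := (-1) ^ (F.filter fun u => u < v).card

lemma sgn_mul_self (v : σ) (F : Finset σ) : sgn K v F * sgn K v F = 1 := by
  rw [sgn, ← mul_pow]; simp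

lemma sgn_insert_of_lt {u v : σ} {F : Finset σ} (h : u < v) (hu : u ∉ F) :
    sgn K v (insert u F) = -sgn K v F := by
  rw [sgn, Finset.filter_insert, if_pos h, Finset.card_insert_of_notMem (by simp [hu]), pow_succ,
    sgn]
  ring

lemma sgn_insert_of_not_lt {u v : σ} {F : Finset σ} (h : ¬ u < v) :
    sgn K v (insert u F) = sgn K v F := by
  rw [sgn, Finset.filter_insert, if_neg h, sgn]

lemma sgn_erase_self (v : σ) (F : Finset σ) : sgn K v (F.erase v) = sgn K v F := by
  by_cases h : v ∈ F
  · conv_rhs => rw [← Finset.insert_erase h, sgn_insert_of_not_lt K (lt_irrefl v)]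
  · rw [Finset.erase_eq_of_notMem h]

lemma sgn_union {v : σ} {F G : Finset σ} (h : Disjoint F G) :
    sgn K v (F ∪ G) = sgn K v F * sgn K v G := by
  rw [sgn, Finset.filter_union, Finset.card_union_of_disjoint
    (Finset.disjoint_filter_filter h), pow_add, sgn, sgn]

/-- Removing two vertices in either order produces opposite signs. -/
lemma sgn_mul_sgn_erase {u v : σ} {F : Finset σ} (hu : u ∈ F) (hv : v ∈ F) (h : u ≠ v) :
    sgn K v F * sgn K u (F.erase v) = -(sgn K u F * sgn K v (F.erase u)) := by
  wlog huv : u < v generalizing u v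
  · rw [this hv hu h.symm (lt_of_le_of_ne (not_lt.1 huv) h.symm), neg_neg]
  have h1 : sgn K v F = -sgn K v (F.erase u) := by
    conv_lhs => rw [← Finset.insert_erase hu, sgn_insert_of_lt K huv (by simp)]
  have h2 : sgn K u F = sgn K u (F.erase v) := by
    conv_lhs => rw [← Finset.insert_erase hv, sgn_insert_of_not_lt K huv.not_gt]
  rw [h1, h2, neg_mul, mul_comm]

lemma boundary_single (F : Finset σ) (a : K) :
    boundary K (Finsupp.single F a) =
      ∑ v ∈ F, Finsupp.single (F.erase v) (a * sgn K v F) := by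
  simp [boundary, Finset.smul_sum, sgn]

lemma boundary_boundary (x : Finset σ →₀ K) : boundary K (boundary K x) = 0 := by
  suffices h : boundary K ∘ₗ boundary K = (0 : (Finset σ →₀ K) →ₗ[K] (Finset σ →₀ K)) by
    rw [← LinearMap.comp_apply, h, LinearMap.zero_apply]
  refine Finsupp.lhom_ext fun F a => ?_
  simp only [LinearMap.comp_apply, boundary_single, map_sum, LinearMap.zero_apply]
  rw [Finset.sum_sigma']
  refine Finset.sum_involution (fun p _ => ⟨p.2, p.1⟩) ?_ ?_ ?_ ?_
  · rintro ⟨v, u⟩ h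
    simp only [Finset.mem_sigma, Finset.mem_erase] at h
    obtain ⟨hv, huv, hu⟩ := h
    dsimp only
    rw [Finset.erase_right_comm, ← Finsupp.single_add, mul_assoc, mul_assoc,
      sgn_mul_sgn_erase K hu hv huv]
    simp
  · rintro ⟨v, u⟩ h _ heq
    simp only [Finset.mem_sigma, Finset.mem_erase] at h
    exact h.2.1 (congrArg Sigma.fst heq)
  · rintro ⟨v, u⟩ h
    simp only [Finset.mem_sigma, Finset.mem_erase] at h ⊢
    exact ⟨h.2.2, h.2.1.symm, h.1⟩
  · rintro ⟨v, u⟩ h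
    rfl

lemma boundary_mem_chains {Δ : LowerSet (Finset σ)} {k : ℤ} {x : Finset σ →₀ K}
    (hx : x ∈ chains K Δ (k + 1)) : boundary K x ∈ chains K Δ k := by
  suffices h : chains K Δ (k + 1) ≤ (chains K Δ k).comap (boundary K) from h hx
  rw [chains_le_iff]
  intro F hF hk
  rw [Submodule.mem_comap, boundary_single]
  refine Submodule.sum_mem _ fun v hv => single_mem_chains K (Δ.lower (F.erase_subset v) hF) ?_ _
  rw [Finset.card_erase_of_mem hv, Nat.cast_sub (Finset.card_pos.2 ⟨v, hv⟩), hk]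
  simp

lemma map_boundary_le_cycles (Δ : LowerSet (Finset σ)) (k : ℤ) :
    (chains K Δ (k + 1)).map (boundary K) ≤ cycles K Δ k := by
  rintro _ ⟨x, hx, rfl⟩
  exact ⟨boundary_mem_chains K hx, boundary_boundary K x⟩

/-- The homotopy `[B] ↦ ± [B ∪ {j}]` that contracts a cone with apex `j`. -/
def coneHomotopy (j : σ) : (Finset σ →₀ K) →ₗ[K] (Finset σ →₀ K) :=
  Finsupp.linearCombination K fun F : Finset σ =>
    if j ∈ F then 0 else Finsupp.single (insert j F) (sgn K j F)

lemma coneHomotopy_single (j : σ) (F : Finset σ) (a : K) :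
    coneHomotopy K j (Finsupp.single F a) =
      if j ∈ F then 0 else Finsupp.single (insert j F) (a * sgn K j F) := by
  simp [coneHomotopy]

lemma boundary_coneHomotopy_add (j : σ) (x : Finset σ →₀ K) :
    boundary K (coneHomotopy K j x) + coneHomotopy K j (boundary K x) = x := by
  suffices h : boundary K ∘ₗ coneHomotopy K j + coneHomotopy K j ∘ₗ boundary K = LinearMap.id from
    LinearMap.congr_fun h x
  refine Finsupp.lhom_ext fun F a => ?_
  simp only [LinearMap.add_apply, LinearMap.comp_apply, LinearMap.id_apply, coneHomotopy_single,
    boundary_single, map_sum]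
  by_cases hj : j ∈ F
  · rw [if_pos hj, map_zero, zero_add, Finset.sum_eq_single_of_mem j hj, if_neg (by simp),
      Finset.insert_erase hj, sgn_erase_self, mul_assoc, sgn_mul_self, mul_one]
    intro v hv hvj
    rw [if_pos (Finset.mem_erase.2 ⟨hvj.symm, hj⟩)]
  · rw [if_neg hj, boundary_single, Finset.sum_insert hj, Finset.erase_insert hj,
      sgn_insert_of_not_lt K (lt_irrefl j), mul_assoc, sgn_mul_self, mul_one, add_assoc,
      ← Finset.sum_add_distrib, Finset.sum_eq_zero, add_zero]
    intro v hv
    have hvj : v ≠ j := fun h => hj (h ▸ hv)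
    rw [if_neg fun h => hj (Finset.mem_of_mem_erase h), Finset.erase_insert_of_ne hvj.symm,
      ← Finsupp.single_add]
    have := sgn_mul_sgn_erase K (F := insert j F) (Finset.mem_insert_self j F)
      (Finset.mem_insert_of_mem hv) hvj.symm
    rw [Finset.erase_insert_of_ne hvj.symm, Finset.erase_insert hj,
      sgn_insert_of_not_lt K (lt_irrefl j), sgn_insert_of_not_lt K (lt_irrefl j)] at this
    rw [← Finsupp.single_zero (M := K) (insert j (F.erase v))]
    congr 1
    linear_combination (a * sgn K j F * sgn K j (F.erase v)) * this -
      (a * sgn K j F * sgn K v (insert j F)) * sgn_mul_self K j (F.erase v) -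
      (a * sgn K v F * sgn K j (F.erase v)) * sgn_mul_self K j F

/-- A cone is acyclic. -/
lemma finrank_reducedHomology_eq_zero_of_cone {Δ : LowerSet (Finset σ)} (j : σ)
    (h : ∀ F ∈ Δ, insert j F ∈ Δ) (k : ℤ) : Module.finrank K (ReducedHomology K Δ k) = 0 := by
  have hmem : ∀ x ∈ chains K Δ k, coneHomotopy K j x ∈ chains K Δ (k + 1) := by
    change chains K Δ k ≤ (chains K Δ (k + 1)).comap (coneHomotopy K j)
    rw [chains_le_iff]
    intro F hF hk
    rw [Submodule.mem_comap, coneHomotopy_single]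
    split_ifs with hj
    · exact Submodule.zero_mem _
    · refine single_mem_chains K (h F hF) ?_ _
      rw [Finset.card_insert_of_notMem hj]
      push_cast
      rw [hk]
  have htop : ((chains K Δ (k + 1)).map (boundary K)).submoduleOf (cycles K Δ k) = ⊤ := by
    rw [eq_top_iff]
    rintro ⟨x, hx, hx'⟩ -
    refine ⟨_, hmem x hx, ?_⟩
    have := boundary_coneHomotopy_add K j x
    rwa [LinearMap.mem_ker.1 hx', map_zero, add_zero] at this
  have : Subsingleton (ReducedHomology K Δ k) := Submodule.Quotient.subsingleton_iff.2 htop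
  exact Module.finrank_zero_of_subsingleton

lemma finrank_reducedHomology_bot (k : ℤ) :
    Module.finrank K (ReducedHomology K (⊥ : LowerSet (Finset σ)) k) = 0 := by
  have : Subsingleton (cycles K (⊥ : LowerSet (Finset σ)) k) := by
    rw [Submodule.subsingleton_iff_eq_bot, cycles, chains]
    simp
  exact Module.finrank_zero_of_subsingleton

end Homology

/-! ### Monomials and monomial fractions -/

section Fractions

variable (K : Type*) [Field K] {σ : Type*} (Δ : LowerSet (Finset σ))

/-- The residue class in `K[Δ]` of the monomial with exponent `e`. -/
def mono (e : σ →₀ ℕ) : StanleyReisnerRing K Δ :=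
  Ideal.Quotient.mk (stanleyReisnerIdeal K Δ) (MvPolynomial.monomial e 1)

lemma mono_add (e e' : σ →₀ ℕ) : mono K Δ (e + e') = mono K Δ e * mono K Δ e' := by
  rw [mono, mono, mono, ← map_mul, MvPolynomial.monomial_mul, one_mul]

lemma mono_pow (e : σ →₀ ℕ) (l : ℕ) : mono K Δ e ^ l = mono K Δ (l • e) := by
  rw [mono, mono, ← map_pow, MvPolynomial.monomial_pow, one_pow]

lemma prod_X_eq_monomial (F : Finset σ) :
    ∏ s ∈ F, (MvPolynomial.X s : MvPolynomial σ K) =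
      MvPolynomial.monomial (∑ s ∈ F, Finsupp.single s 1) 1 := by
  simp [MvPolynomial.monomial_sum_one, MvPolynomial.X]

/-- The nonzero monomials of `K[Δ]` are those supported on faces. -/
lemma mono_eq_zero_iff {e : σ →₀ ℕ} : mono K Δ e = 0 ↔ e.support ∉ Δ := by
  classical
  have hI : stanleyReisnerIdeal K Δ = Ideal.span ((fun e => MvPolynomial.monomial e (1 : K)) ''
      {e | ∃ F : Finset σ, F ∉ Δ ∧ e = ∑ s ∈ F, Finsupp.single s 1}) := by
    rw [stanleyReisnerIdeal]
    congr 1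
    ext p
    constructor
    · rintro ⟨F, hF, rfl⟩
      exact ⟨_, ⟨F, hF, rfl⟩, (prod_X_eq_monomial K F).symm⟩
    · rintro ⟨_, ⟨F, hF, rfl⟩, rfl⟩
      exact ⟨F, hF, (prod_X_eq_monomial K F).symm⟩
  have happ (F : Finset σ) (s : σ) :
      (∑ t ∈ F, Finsupp.single t 1 : σ →₀ ℕ) s = if s ∈ F then 1 else 0 := by
    simp [Finsupp.finsetSum_apply, Finsupp.single_apply]
  rw [mono, Ideal.Quotient.eq_zero_iff_mem, hI, MvPolynomial.mem_ideal_span_monomial_image]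
  have hs : (MvPolynomial.monomial e (1 : K)).support = {e} := by
    rw [MvPolynomial.support_monomial, if_neg one_ne_zero]
  rw [hs]
  constructor
  · intro h hΔ
    obtain ⟨_, ⟨F, hF, rfl⟩, hle⟩ := h e (Finset.mem_singleton_self e)
    refine hF (Δ.lower ?_ hΔ)
    intro s hs
    have := hle s
    rw [happ, if_pos hs] at this
    rw [Finsupp.mem_support_iff]
    omega
  · intro h e' he'
    rw [Finset.mem_singleton] at he'
    subst he'
    refine ⟨_, ⟨_, h, rfl⟩, fun s => ?_⟩
    rw [happ]
    split_ifs with hs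
    · rw [Finsupp.mem_support_iff] at hs
      omega
    · exact Nat.zero_le _

variable {ι : Type*} (w : ι ↪ σ)

/-- The exponent of the monomial `y_F`. -/
def expo (F : Finset ι) : σ →₀ ℕ := ∑ j ∈ F, Finsupp.single (w j) 1

lemma expo_apply [DecidableEq σ] (F : Finset ι) (s : σ) :
    expo w F s = if s ∈ F.map w then 1 else 0 := by
  have : expo w F = ∑ t ∈ F.map w, Finsupp.single t 1 := by rw [Finset.sum_map, expo]
  rw [this]
  simp [Finsupp.finsetSum_apply, Finsupp.single_apply, -Finset.sum_map, -Finset.mem_map]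

lemma prod_vars (F : Finset ι) : ∏ j ∈ F, vars K Δ w j = mono K Δ (expo w F) := by
  simp only [vars]
  have h := prod_X_eq_monomial K (F.map w)
  rw [Finset.sum_map, Finset.prod_map] at h
  rw [← map_prod, mono, expo, h]

lemma prod_vars_pow (F : Finset ι) (l : ℕ) :
    (∏ j ∈ F, vars K Δ w j) ^ l = mono K Δ (l • expo w F) := by
  rw [prod_vars, mono_pow]

lemma isUnit_algebraMap_mono (F : Finset ι) (l : ℕ) : IsUnit
    (algebraMap _ (CechTerm (vars K Δ w) F) (mono K Δ (l • expo w F))) := by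
  rw [← prod_vars_pow, map_pow]
  exact (IsLocalization.Away.algebraMap_isUnit _).pow l

/-- The fraction `x^e / y_F^l`. -/
def frac (F : Finset ι) (e : σ →₀ ℕ) (l : ℕ) : CechTerm (vars K Δ w) F :=
  Localization.mk (mono K Δ e)
    (⟨(∏ j ∈ F, vars K Δ w j) ^ l, l, rfl⟩ : Submonoid.powers (∏ j ∈ F, vars K Δ w j))

/-- The degree `e - l • deg y_F` of the fraction `x^e / y_F^l`. -/
def fracDegree (F : Finset ι) (e : σ →₀ ℕ) (l : ℕ) : σ → ℤ :=
  fun s => (e s : ℤ) - l * expo w F s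

variable {w}

lemma frac_mul_algebraMap (F : Finset ι) (e : σ →₀ ℕ) (l : ℕ) :
    frac K Δ w F e l * algebraMap _ _ (mono K Δ (l • expo w F)) =
      algebraMap _ _ (mono K Δ e) := by
  rw [← prod_vars_pow, frac, Localization.mk_eq_mk']
  exact IsLocalization.mk'_spec _ _ _

/-- A monomial fraction is determined by its degree. -/
lemma frac_eq_frac {F : Finset ι} {e e' : σ →₀ ℕ} {l l' : ℕ}
    (h : fracDegree w F e l = fracDegree w F e' l') : frac K Δ w F e l = frac K Δ w F e' l' := by
  rw [frac, frac, Localization.mk_eq_mk_iff, Localization.r_iff_exists]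
  refine ⟨1, ?_⟩
  dsimp only
  rw [prod_vars, mono_pow, mono_pow, ← mono_add, ← mono_add]
  congr 2
  ext s
  have := congrFun h s
  simp only [fracDegree] at this
  simp only [Finsupp.add_apply, Finsupp.smul_apply, smul_eq_mul]
  zify
  linarith

/-- Multiplying by powers of `y_F` enlarges the support of `e` by `w(F)`, so a fraction vanishes
unless the union of the two is a face. -/
lemma frac_eq_zero_iff [DecidableEq σ] {F : Finset ι} {e : σ →₀ ℕ} {l : ℕ} :
    frac K Δ w F e l = 0 ↔ e.support ∪ F.map w ∉ Δ := by
  have key (k : ℕ) : mono K Δ (expo w F) ^ (k + 1) * mono K Δ e = 0 ↔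
      e.support ∪ F.map w ∉ Δ := by
    rw [mono_pow, ← mono_add, mono_eq_zero_iff]
    suffices h : ((k + 1) • expo w F + e).support = e.support ∪ F.map w by rw [h]
    ext s
    rw [Finset.mem_union, Finsupp.mem_support_iff, Finsupp.mem_support_iff, Finsupp.add_apply,
      Finsupp.smul_apply, expo_apply, smul_eq_mul]
    split_ifs with hs <;> simp [hs]
  rw [frac, Localization.mk_eq_mk', IsLocalization.mk'_eq_zero_iff]
  constructor
  · rintro ⟨⟨_, k, rfl⟩, hk⟩
    rw [← key k, pow_succ', mul_assoc]
    dsimp only at hk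
    rw [prod_vars] at hk
    rw [hk, mul_zero]
  · intro h
    refine ⟨⟨_, 1, rfl⟩, ?_⟩
    dsimp only
    rw [prod_vars]
    exact (key 0).2 h

/-- The Čech maps carry a monomial fraction to the monomial fraction of the same degree. -/
lemma cechMap_frac {F F' : Finset ι} (h : F ⊆ F') (e : σ →₀ ℕ) (l : ℕ) :
    ∃ e', fracDegree w F' e' l = fracDegree w F e l ∧
      cechMap (vars K Δ w) h (frac K Δ w F e l) = frac K Δ w F' e' l := by
  classical
  have hsum : expo w F' = expo w (F' \ F) + expo w F := by
    rw [expo, expo, expo, Finset.sum_sdiff h]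
  refine ⟨e + l • expo w (F' \ F), ?_, ?_⟩
  · ext s
    simp only [fracDegree, hsum]
    simp
    ring
  · have h1 := congrArg (cechMap (vars K Δ w) h) (frac_mul_algebraMap K Δ (w := w) F e l)
    rw [map_mul, AlgHom.commutes, AlgHom.commutes] at h1
    rw [← (isUnit_algebraMap_mono K Δ w F' l).mul_left_inj, frac_mul_algebraMap, mono_add, map_mul,
      ← h1, hsum, smul_add, mono_add, map_mul]
    ring

lemma cechMap_smul {F F' : Finset ι} (h : F ⊆ F') (a : K) (z : CechTerm (vars K Δ w) F) :
    cechMap (vars K Δ w) h (a • z) = a • cechMap (vars K Δ w) h z := by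
  rw [← IsScalarTower.algebraMap_smul (StanleyReisnerRing K Δ) a z, map_smul,
    IsScalarTower.algebraMap_smul]

variable (w)

/-- The monomial fractions span `K[Δ]_{y_F}` over `K`. -/
lemma span_frac (F : Finset ι) :
    Submodule.span K (Set.range fun p : (σ →₀ ℕ) × ℕ => frac K Δ w F p.1 p.2) = ⊤ := by
  rw [eq_top_iff]
  rintro z -
  induction z using Localization.induction_on with | _ q
  obtain ⟨p, _, l, rfl⟩ := q
  obtain ⟨p, rfl⟩ := Ideal.Quotient.mk_surjective p
  induction p using MvPolynomial.induction_on' with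
  | monomial e a =>
    have h : Ideal.Quotient.mk (stanleyReisnerIdeal K Δ) (MvPolynomial.monomial e a) =
        a • mono K Δ e := by
      rw [mono, ← Ideal.Quotient.mkₐ_eq_mk K, ← map_smul, MvPolynomial.smul_monomial,
        smul_eq_mul, mul_one]
    rw [h, ← Localization.smul_mk]
    exact Submodule.smul_mem _ _ (Submodule.subset_span ⟨(e, l), rfl⟩)
  | add p q hp hq =>
    rw [map_add, ← Localization.add_mk_self]
    exact Submodule.add_mem _ hp hq

open Classical in
/-- The monomial fraction of degree `c` in `K[Δ]_{y_F}`, which is unique by `frac_eq_frac`; zero if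
there is none, that is, if `c` is negative somewhere outside of `w(F)`. -/
def gen (F : Finset ι) (c : σ → ℤ) : CechTerm (vars K Δ w) F :=
    if h : ∃ p : (σ →₀ ℕ) × ℕ, fracDegree w F p.1 p.2 = c then
      frac K Δ w F (Exists.choose h).1 (Exists.choose h).2
    else 0

lemma gen_eq (F : Finset ι) {c : σ → ℤ} {e : σ →₀ ℕ} {l : ℕ} (h : fracDegree w F e l = c) :
    gen K Δ w F c = frac K Δ w F e l := by
  have h' : ∃ p : (σ →₀ ℕ) × ℕ, fracDegree w F p.1 p.2 = c := ⟨(e, l), h⟩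
  rw [gen, dif_pos h']
  exact frac_eq_frac K Δ (h'.choose_spec.trans h.symm)

end Fractions

/-! ### Projection onto a degree -/

section Coaction

variable (K : Type*) [Field K] {σ : Type*} [DecidableEq σ] (Δ : LowerSet (Finset σ)) {ι : Type*}
  (w : ι ↪ σ) (F : Finset ι)

/-- The map `K[X] → K[Δ]_{y_F}[T^±]` with `X_s ↦ x_s T_s`. -/
def coactPolynomial :
    MvPolynomial σ K →ₐ[K] AddMonoidAlgebra (CechTerm (vars K Δ w) F) (σ → ℤ) :=
  MvPolynomial.aeval fun s => AddMonoidAlgebra.single (Pi.single s 1)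
    (algebraMap _ _ (mono K Δ (Finsupp.single s 1)))

lemma coactPolynomial_monomial (e : σ →₀ ℕ) :
    coactPolynomial K Δ w F (MvPolynomial.monomial e 1) =
      AddMonoidAlgebra.single (fun s => (e s : ℤ)) (algebraMap _ _ (mono K Δ e)) := by
  induction e using Finsupp.induction_linear with
  | zero =>
    have h1 : mono K Δ 0 = 1 := map_one _
    have h2 : MvPolynomial.monomial (0 : σ →₀ ℕ) (1 : K) = 1 := rfl
    rw [h1, h2, map_one, map_one, AddMonoidAlgebra.one_def]
    rfl
  | add e e' he he' =>
    have : (MvPolynomial.monomial (e + e') (1 : K)) =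
        MvPolynomial.monomial e 1 * MvPolynomial.monomial e' 1 := by
      rw [MvPolynomial.monomial_mul, one_mul]
    rw [this, map_mul, he, he', AddMonoidAlgebra.single_mul_single, mono_add, map_mul]
    rfl
  | single s k =>
    rw [coactPolynomial, MvPolynomial.aeval_monomial, map_one, one_mul, Finsupp.prod_single_index]
    swap
    · exact pow_zero _
    rw [AddMonoidAlgebra.single_pow, ← map_pow, mono_pow]
    congr 1
    · ext t
      by_cases h : s = t
      · subst h; simp
      · simp [Ne.symm h]
    · simp

/-- The map `K[Δ] → K[Δ]_{y_F}[T^±]` with `x_s ↦ x_s T_s`. -/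
def coactRing :
    StanleyReisnerRing K Δ →ₐ[K] AddMonoidAlgebra (CechTerm (vars K Δ w) F) (σ → ℤ) :=
  Ideal.Quotient.liftₐ (stanleyReisnerIdeal K Δ) (coactPolynomial K Δ w F) <| by
    suffices h : stanleyReisnerIdeal K Δ ≤ RingHom.ker (coactPolynomial K Δ w F) from
      fun a ha => h ha
    refine Ideal.span_le.2 ?_
    rintro _ ⟨A, hA, rfl⟩
    have h0 : mono K Δ (∑ s ∈ A, Finsupp.single s 1) = 0 := by
      rw [mono, ← prod_X_eq_monomial, Ideal.Quotient.eq_zero_iff_mem]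
      exact Ideal.subset_span ⟨A, hA, rfl⟩
    rw [SetLike.mem_coe, RingHom.mem_ker, prod_X_eq_monomial, coactPolynomial_monomial, h0,
      map_zero, AddMonoidAlgebra.single_zero]

lemma coactRing_mono (e : σ →₀ ℕ) : coactRing K Δ w F (mono K Δ e) =
    AddMonoidAlgebra.single (fun s => (e s : ℤ)) (algebraMap _ _ (mono K Δ e)) :=
  coactPolynomial_monomial K Δ w F e

lemma isUnit_coactRing (y : Submonoid.powers (∏ j ∈ F, vars K Δ w j)) :
    IsUnit (coactRing K Δ w F y) := by
  obtain ⟨_, l, rfl⟩ := y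
  dsimp only
  obtain ⟨b, hb⟩ := (isUnit_algebraMap_mono K Δ w F l).exists_right_inv
  rw [prod_vars_pow, coactRing_mono]
  refine IsUnit.of_mul_eq_one
    (AddMonoidAlgebra.single (-fun s => ((l • expo w F) s : ℤ)) b) ?_
  rw [AddMonoidAlgebra.single_mul_single, hb, add_neg_cancel, AddMonoidAlgebra.one_def]

/-- The fine grading of `K[Δ]_{y_F}`, encoded as a coaction of the group algebra of `ℤ^σ`: the ring
homomorphism `K[Δ]_{y_F} → K[Δ]_{y_F}[T^±]` that multiplies a fraction of degree `c` by `T^c`. -/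
def coact :
    CechTerm (vars K Δ w) F →ₐ[K] AddMonoidAlgebra (CechTerm (vars K Δ w) F) (σ → ℤ) :=
  IsLocalization.liftAlgHom (M := Submonoid.powers (∏ j ∈ F, vars K Δ w j))
    (f := coactRing K Δ w F) (isUnit_coactRing K Δ w F)

lemma coact_algebraMap (x : StanleyReisnerRing K Δ) :
    coact K Δ w F (algebraMap _ _ x) = coactRing K Δ w F x :=
  IsLocalization.lift_eq (isUnit_coactRing K Δ w F) x

lemma coact_frac (e : σ →₀ ℕ) (l : ℕ) : coact K Δ w F (frac K Δ w F e l) =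
    AddMonoidAlgebra.single (fracDegree w F e l) (frac K Δ w F e l) := by
  have hu := isUnit_coactRing K Δ w F ⟨_, l, rfl⟩
  dsimp only at hu
  rw [prod_vars_pow] at hu
  rw [← hu.mul_left_inj, ← coact_algebraMap, ← map_mul, frac_mul_algebraMap, coact_algebraMap,
    coact_algebraMap, coactRing_mono, coactRing_mono, AddMonoidAlgebra.single_mul_single,
    frac_mul_algebraMap]
  congr 1
  ext s
  simp [fracDegree]

/-- The projection of `K[Δ]_{y_F}` onto its component of degree `c`. -/
def degreeProj (c : σ → ℤ) : CechTerm (vars K Δ w) F →ₗ[K] CechTerm (vars K Δ w) F where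
  toFun z := (coact K Δ w F z).coeff c
  map_add' a b := by simp
  map_smul' a b := by simp

lemma degreeProj_frac (e : σ →₀ ℕ) (l : ℕ) :
    degreeProj K Δ w F (fracDegree w F e l) (frac K Δ w F e l) = frac K Δ w F e l := by
  change (coact K Δ w F (frac K Δ w F e l)).coeff _ = _
  rw [coact_frac, AddMonoidAlgebra.coeff_single, Finsupp.single_eq_same]

lemma degreeProj_frac_of_ne {c : σ → ℤ} {e : σ →₀ ℕ} {l : ℕ} (h : fracDegree w F e l ≠ c) :
    degreeProj K Δ w F c (frac K Δ w F e l) = 0 := by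
  change (coact K Δ w F (frac K Δ w F e l)).coeff _ = _
  rw [coact_frac, AddMonoidAlgebra.coeff_single, Finsupp.single_eq_of_ne h.symm]

lemma cechTermDegree_eq_span (c : σ → ℤ) : cechTermDegree K Δ w F c =
    Submodule.span K {z | ∃ e l, fracDegree w F e l = c ∧ z = frac K Δ w F e l} := by
  rw [cechTermDegree]
  congr 1
  ext z
  refine exists_congr fun e => exists_congr fun l => and_congr_left' ?_
  rw [funext_iff]
  refine forall_congr' fun s => ?_
  rw [fracDegree, expo_apply]
  push_cast
  rfl

lemma degreeProj_mem (c : σ → ℤ) (z : CechTerm (vars K Δ w) F) :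
    degreeProj K Δ w F c z ∈ cechTermDegree K Δ w F c := by
  suffices h : ⊤ ≤ (cechTermDegree K Δ w F c).comap (degreeProj K Δ w F c) from h trivial
  rw [← span_frac, Submodule.span_le]
  rintro _ ⟨⟨e, l⟩, rfl⟩
  simp only [SetLike.mem_coe, Submodule.mem_comap]
  by_cases h : fracDegree w F e l = c
  · subst h
    rw [degreeProj_frac, cechTermDegree_eq_span]
    exact Submodule.subset_span ⟨e, l, rfl, rfl⟩
  · rw [degreeProj_frac_of_ne K Δ w F h]
    exact Submodule.zero_mem _

lemma degreeProj_of_mem {c : σ → ℤ} {z : CechTerm (vars K Δ w) F}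
    (hz : z ∈ cechTermDegree K Δ w F c) : degreeProj K Δ w F c z = z := by
  rw [cechTermDegree_eq_span] at hz
  induction hz using Submodule.span_induction with
  | mem z hz =>
    obtain ⟨e, l, rfl, rfl⟩ := hz
    rw [degreeProj_frac]
  | zero => exact map_zero _
  | add x y _ _ hx hy => rw [map_add, hx, hy]
  | smul a x _ hx => rw [map_smul, hx]

lemma degreeProj_cechMap {F F' : Finset ι} (h : F ⊆ F') (c : σ → ℤ)
    (z : CechTerm (vars K Δ w) F) :
    degreeProj K Δ w F' c (cechMap (vars K Δ w) h z) =
      cechMap (vars K Δ w) h (degreeProj K Δ w F c z) := by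
  have hz : z ∈ (⊤ : Submodule K _) := trivial
  rw [← span_frac] at hz
  induction hz using Submodule.span_induction with
  | mem z hz =>
    obtain ⟨⟨e, l⟩, rfl⟩ := hz
    obtain ⟨e', he', h'⟩ := cechMap_frac K Δ (w := w) h e l
    dsimp only
    by_cases hc : fracDegree w F e l = c
    · subst hc
      rw [degreeProj_frac, h', ← he', degreeProj_frac]
    · rw [degreeProj_frac_of_ne K Δ w F hc, h', map_zero,
        degreeProj_frac_of_ne K Δ w F' (he' ▸ hc)]
  | zero => simp only [map_zero]
  | add x y _ _ hx hy => simp only [map_add, hx, hy]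
  | smul a x _ hx => rw [cechMap_smul, map_smul, map_smul, cechMap_smul, hx]

lemma cechTermDegree_eq_span_gen (c : σ → ℤ) :
    cechTermDegree K Δ w F c = Submodule.span K {gen K Δ w F c} := by
  rw [cechTermDegree_eq_span]
  apply le_antisymm
  · rw [Submodule.span_le]
    rintro _ ⟨e, l, h, rfl⟩
    rw [← gen_eq K Δ w F h]
    exact Submodule.mem_span_singleton_self _
  · rw [Submodule.span_singleton_le_iff_mem, gen]
    split_ifs with h
    · exact Submodule.subset_span ⟨_, _, h.choose_spec, rfl⟩
    · exact Submodule.zero_mem _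

variable [Fintype σ]

/-- The vertices at which `c` is negative. -/
def negSupport (c : σ → ℤ) : Finset σ := Finset.univ.filter fun s => c s < 0

/-- The vertices at which `c` is nonzero. -/
def intSupport (c : σ → ℤ) : Finset σ := Finset.univ.filter fun s => c s ≠ 0

/-- The degrees of monomial fractions in `K[Δ]_{y_F}` are those that are nonnegative outside of
`w(F)`. -/
lemma exists_fracDegree_iff (c : σ → ℤ) :
    (∃ e l, fracDegree w F e l = c) ↔ negSupport c ⊆ F.map w := by
  constructor
  · rintro ⟨e, l, rfl⟩ s hs
    simp only [negSupport, Finset.mem_filter, Finset.mem_univ, true_and, fracDegree,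
      expo_apply] at hs
    by_contra h
    rw [if_neg h] at hs
    push_cast at hs
    omega
  · intro h
    -- A common exponent of the denominator that clears all negative entries of `c`.
    refine ⟨Finsupp.equivFunOnFinite.symm fun s =>
      (c s + (∑ t, (c t).natAbs) * expo w F s).toNat, ∑ t, (c t).natAbs, ?_⟩
    ext s
    rw [fracDegree, Finsupp.equivFunOnFinite_symm_apply_apply, Int.toNat_of_nonneg]
    · ring
    · rw [expo_apply]
      split_ifs with hs
      · have := Finset.single_le_sum (f := fun t => (c t).natAbs) (fun _ _ => Nat.zero_le _)
          (Finset.mem_univ s)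
        generalize ∑ t, (c t).natAbs = L at this ⊢
        push_cast
        omega
      · by_contra hc
        refine hs (h ?_)
        simp only [negSupport, Finset.mem_filter, Finset.mem_univ, true_and]
        push_cast at hc
        omega

lemma gen_ne_zero_iff (c : σ → ℤ) : gen K Δ w F c ≠ 0 ↔
    negSupport c ⊆ F.map w ∧ intSupport c ∪ F.map w ∈ Δ := by
  by_cases h : ∃ e l, fracDegree w F e l = c
  · rw [and_iff_right ((exists_fracDegree_iff w F c).1 h)]
    obtain ⟨e, l, h⟩ := h
    rw [gen_eq K Δ w F h, Ne, frac_eq_zero_iff, not_not]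
    suffices h : e.support ∪ F.map w = intSupport c ∪ F.map w by rw [h]
    subst h
    ext s
    by_cases hs : s ∈ F.map w
    · simp only [Finset.mem_union, hs, or_true]
    · simp [-Finset.mem_map, hs, intSupport, fracDegree, expo_apply]
  · have h' : ¬ negSupport c ⊆ F.map w := fun h' => h ((exists_fracDegree_iff w F c).2 h')
    have : gen K Δ w F c = 0 := by
      rw [gen, dif_neg]
      rintro ⟨p, hp⟩
      exact h ⟨_, _, hp⟩
    simp [this, h']

lemma cechMap_gen {F F' : Finset ι} (h : F ⊆ F') {c : σ → ℤ} (hc : negSupport c ⊆ F.map w) :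
    cechMap (vars K Δ w) h (gen K Δ w F c) = gen K Δ w F' c := by
  obtain ⟨e, l, he⟩ := (exists_fracDegree_iff w F c).2 hc
  obtain ⟨e', he', h'⟩ := cechMap_frac K Δ (w := w) h e l
  rw [gen_eq K Δ w F he, h', gen_eq K Δ w F' (he'.trans he)]

end Coaction

/-! ### Dimension counts -/

section LinearAlgebra

variable {K U V : Type*} [Field K] [AddCommGroup U] [Module K U] [AddCommGroup V] [Module K V]

lemma finrank_map_add_finrank_inf_ker (f : U →ₗ[K] V) (S : Submodule K U) [FiniteDimensional K S] :
    Module.finrank K (S.map f) + Module.finrank K (S ⊓ LinearMap.ker f : Submodule K U) =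
      Module.finrank K S := by
  rw [← LinearMap.finrank_range_add_finrank_ker (f.domRestrict S), LinearMap.range_domRestrict,
    LinearMap.ker_domRestrict, ← Submodule.map_comap_subtype, Submodule.finrank_map_subtype_eq]

end LinearAlgebra

section Homology

variable (K : Type*) [Field K] {σ : Type*} [LinearOrder σ] [Fintype σ]

/-- The dimension of reduced homology in terms of the ranks of the boundary maps. -/
lemma finrank_reducedHomology_add (Δ : LowerSet (Finset σ)) (k : ℤ) :
    Module.finrank K (ReducedHomology K Δ k) +
        Module.finrank K ((chains K Δ (k + 1)).map (boundary K)) +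
        Module.finrank K ((chains K Δ k).map (boundary K)) =
      Module.finrank K (chains K Δ k) := by
  rw [← finrank_map_add_finrank_inf_ker (boundary K) (chains K Δ k), add_comm]
  congr 1
  rw [← (Submodule.submoduleOfEquivOfLe (map_boundary_le_cycles K Δ k)).finrank_eq]
  exact Submodule.finrank_quotient_add_finrank _

end Homology

lemma neg_one_pow_smul (K : Type*) [Field K] {R M : Type*} [CommRing R] [AddCommGroup M]
    [Module R M]
    [Module K M] (k : ℕ) (x : M) : (-1 : R) ^ k • x = (-1 : K) ^ k • x := by
  rcases Nat.even_or_odd k with h | h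
  · rw [h.neg_one_pow, h.neg_one_pow, one_smul, one_smul]
  · rw [h.neg_one_pow, h.neg_one_pow, neg_smul, neg_smul, one_smul, one_smul]

section ChainsProj

variable (K : Type*) [Field K] {σ : Type*} (Δ : LowerSet (Finset σ)) (k : ℤ)

open Classical in
/-- The projection of the chains of the full simplex onto the `k`-chains of `Δ`. -/
def chainsProj : (Finset σ →₀ K) →ₗ[K] chains K Δ k := Finsupp.restrictDom K K _

lemma chainsProj_of_mem {x : Finset σ →₀ K} (hx : x ∈ chains K Δ k) :
    chainsProj K Δ k x = ⟨x, hx⟩ := by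
  classical
  exact LinearMap.congr_fun (Finsupp.restrictDom_comp_subtype _) (⟨x, hx⟩ : chains K Δ k)

variable {Δ k} in
lemma chainsProj_single_of_card_ne {B : Finset σ} (hB : (B.card : ℤ) ≠ k + 1) (a : K) :
    chainsProj K Δ k (Finsupp.single B a) = 0 := by
  classical
  ext x
  change (Finsupp.restrictDom K K {F | F ∈ Δ ∧ (F.card : ℤ) = k + 1} _ : Finset σ →₀ K) x = 0
  rw [Finsupp.restrictDom_apply, Finsupp.filter_single_of_neg _ fun h => hB h.2]
  rfl

end ChainsProj

/-! ### Homogeneous Čech cochains -/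

section Cochains

variable {σ ι : Type*} [LinearOrder ι] (w : ι ↪ σ) (K : Type*) [Field K] (Δ : LowerSet (Finset σ))

lemma cechD_apply (x : ∀ F, CechTerm (vars K Δ w) F) (F : Finset ι) :
    cechD (vars K Δ w) x F = ∑ j ∈ F, sgn K j F •
      cechMap (vars K Δ w) (F.erase_subset j) (x (F.erase j)) := by
  simp only [cechD, LinearMap.pi_apply, LinearMap.sum_apply, LinearMap.smul_apply, sgn,
    LinearMap.comp_apply, LinearMap.proj_apply, AlgHom.toLinearMap_apply]
  exact Finset.sum_congr rfl fun j _ => neg_one_pow_smul K _ _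

lemma cechD_mem_cechCochains {t : ℤ} {x : ∀ F, CechTerm (vars K Δ w) F}
    (hx : x ∈ cechCochains (vars K Δ w) (t - 1)) :
    cechD (vars K Δ w) x ∈ cechCochains (vars K Δ w) t := by
  intro F hF
  rw [cechD_apply]
  refine Finset.sum_eq_zero fun j hj => ?_
  rw [hx, map_zero, smul_zero]
  rw [Finset.card_erase_of_mem hj, Nat.cast_sub (Finset.card_pos.2 ⟨j, hj⟩)]
  push_cast
  omega

lemma subtype_restrictScalars_injective (t : ℤ) : Function.Injective
    ((cechCocycles (vars K Δ w) t).subtype.restrictScalars K) :=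
  Subtype.val_injective

variable [DecidableEq σ] (c : σ → ℤ)

/-- The homogeneous Čech cochains of cohomological degree `t` and fine degree `c`. -/
def degreeCochains (t : ℤ) : Submodule K (∀ F, CechTerm (vars K Δ w) F) :=
  (Submodule.pi Set.univ fun F => cechTermDegree K Δ w F c) ⊓
    (cechCochains (vars K Δ w) t).restrictScalars K

/-- The homogeneous Čech cocycles of fine degree `c`, as a subspace of the Čech cocycles. -/
def degreeCocycles (t : ℤ) : Submodule K (cechCocycles (vars K Δ w) t) :=
  (Submodule.pi Set.univ fun F => cechTermDegree K Δ w F c).comap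
    ((cechCocycles (vars K Δ w) t).subtype.restrictScalars K)

lemma map_degreeCocycles (t : ℤ) : (degreeCocycles w K Δ c t).map
      ((cechCocycles (vars K Δ w) t).subtype.restrictScalars K) =
    degreeCochains w K Δ c t ⊓ LinearMap.ker ((cechD (vars K Δ w)).restrictScalars K) := by
  ext x
  constructor
  · rintro ⟨⟨x, hx, hx'⟩, hpi, rfl⟩
    exact ⟨⟨hpi, hx⟩, hx'⟩
  · rintro ⟨⟨hpi, hx⟩, hx'⟩
    exact ⟨⟨x, hx, hx'⟩, hpi, rfl⟩

end Cochains

/-! ### The Čech complex in a fixed degree -/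

section CechDegree

variable {σ ι : Type*} [Fintype ι] (w : ι ↪ σ) (c : σ → ℤ)

/-- The indices `j` for which `c` is negative at `w j`. -/
def negIndex : Finset ι := Finset.univ.filter fun j => c (w j) < 0

lemma negSupport_subset_map_iff [Fintype σ] (F : Finset ι) : negSupport c ⊆ F.map w ↔
    negSupport c ⊆ (negIndex w c).map w ∧ negIndex w c ⊆ F := by
  constructor
  · intro h
    refine ⟨fun s hs => ?_, fun j hj => ?_⟩
    · obtain ⟨j, -, rfl⟩ := Finset.mem_map.1 (h hs)
      exact Finset.mem_map_of_mem w (by simpa [negIndex, negSupport] using hs)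
    · have : w j ∈ negSupport c := by simpa [negIndex, negSupport] using hj
      exact (Finset.mem_map' w).1 (h this)
  · rintro ⟨h, h'⟩
    exact h.trans (Finset.map_subset_map.2 h')

variable [LinearOrder ι]

section Twist

variable (K : Type*) [Field K]

/-- The sign that relates the Čech differential on the terms of `N ∪ B`, `N = negIndex w c`, to the
boundary map. -/
def twist (B : Finset ι) : K := ∏ j ∈ B, sgn K j (negIndex w c)

lemma twist_mul_self (B : Finset ι) : twist w c K B * twist w c K B = 1 := by
  rw [twist, ← Finset.prod_mul_distrib]
  exact Finset.prod_eq_one fun j _ => sgn_mul_self K j _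

lemma twist_ne_zero (B : Finset ι) : twist w c K B ≠ 0 :=
  left_ne_zero_of_mul_eq_one (twist_mul_self w c K B)

lemma twist_erase {B : Finset ι} {j : ι} (hj : j ∈ B) :
    twist w c K B = sgn K j (negIndex w c) * twist w c K (B.erase j) := by
  rw [twist, twist, Finset.mul_prod_erase _ (fun j => sgn K j (negIndex w c)) hj]

variable (Δ : LowerSet (Finset σ))

/-- The Čech cochain of degree `c` attached to a linear form on the chains of the full simplex. -/
def toCech : Module.Dual K (Finset ι →₀ K) →ₗ[K] ∀ F, CechTerm (vars K Δ w) F where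
  toFun f F := if negIndex w c ⊆ F then
    (twist w c K (F \ negIndex w c) * f (Finsupp.single (F \ negIndex w c) 1)) • gen K Δ w F c
    else 0
  map_add' f g := by
    ext F
    simp only [Pi.add_apply]
    split_ifs
    · rw [LinearMap.add_apply, mul_add, add_smul]
    · rw [add_zero]
  map_smul' a f := by
    ext F
    simp only [Pi.smul_apply, RingHom.id_apply]
    split_ifs
    · rw [LinearMap.smul_apply, smul_eq_mul, mul_left_comm, mul_smul]
    · rw [smul_zero]

lemma toCech_apply_of_subset (f : Module.Dual K (Finset ι →₀ K)) {F : Finset ι}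
    (h : negIndex w c ⊆ F) : toCech w c K Δ f F =
      (twist w c K (F \ negIndex w c) * f (Finsupp.single (F \ negIndex w c) 1)) •
        gen K Δ w F c := if_pos h

lemma toCech_apply_of_not_subset (f : Module.Dual K (Finset ι →₀ K)) {F : Finset ι}
    (h : ¬ negIndex w c ⊆ F) : toCech w c K Δ f F = 0 := if_neg h

lemma toCech_mem_pi [DecidableEq σ] (f : Module.Dual K (Finset ι →₀ K)) :
    toCech w c K Δ f ∈ Submodule.pi Set.univ fun F => cechTermDegree K Δ w F c := by
  intro F _
  change _ ∈ cechTermDegree K Δ w F c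
  rw [cechTermDegree_eq_span_gen]
  by_cases hF : negIndex w c ⊆ F
  · rw [toCech_apply_of_subset _ _ _ _ _ hF]
    exact Submodule.smul_mem _ _ (Submodule.mem_span_singleton_self _)
  · rw [toCech_apply_of_not_subset _ _ _ _ _ hF]
    exact Submodule.zero_mem _

end Twist

variable [Fintype σ] [DecidableEq σ]

/-- The complex on `ι` whose homology computes the component of degree `c` of the local cohomology:
the sets `B` disjoint from `negIndex w c` such that the term of `negIndex w c ∪ B` of the Čech
complex is nonzero in degree `c`. -/
def degreeComplex (Δ : LowerSet (Finset σ)) : LowerSet (Finset ι) where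
  carrier := {B | negSupport c ⊆ (negIndex w c).map w ∧ Disjoint (negIndex w c) B ∧
    intSupport c ∪ (negIndex w c ∪ B).map w ∈ Δ}
  lower' := fun _ _ hCB hB => ⟨hB.1, hB.2.1.mono_right hCB, Δ.lower (Finset.union_subset_union_right
    (Finset.map_subset_map.2 (Finset.union_subset_union_right hCB))) hB.2.2⟩

variable (K : Type*) [Field K] (Δ : LowerSet (Finset σ))

lemma gen_union_ne_zero_iff {B : Finset ι} (hB : Disjoint (negIndex w c) B) :
    gen K Δ w (negIndex w c ∪ B) c ≠ 0 ↔ B ∈ degreeComplex w c Δ := by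
  rw [gen_ne_zero_iff, negSupport_subset_map_iff,
    and_iff_left (b := negIndex w c ⊆ _) Finset.subset_union_left]
  exact and_congr_right' (and_iff_right hB).symm

lemma toCech_eq_zero_iff (f : Module.Dual K (Finset ι →₀ K)) : toCech w c K Δ f = 0 ↔
    ∀ B ∈ degreeComplex w c Δ, f (Finsupp.single B 1) = 0 := by
  constructor
  · intro h B hB
    have := congrFun h (negIndex w c ∪ B)
    rw [toCech_apply_of_subset _ _ _ _ _ Finset.subset_union_left,
      Finset.union_sdiff_cancel_left hB.2.1, Pi.zero_apply, smul_eq_zero] at this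
    have h1 := (gen_union_ne_zero_iff w c K Δ hB.2.1).2 hB
    have h2 := twist_ne_zero w c K B
    simpa [h1, h2] using this
  · intro h
    ext F
    by_cases hF : negIndex w c ⊆ F
    · rw [toCech_apply_of_subset _ _ _ _ _ hF]
      have := gen_union_ne_zero_iff w c K Δ (B := F \ negIndex w c) Finset.disjoint_sdiff
      rw [Finset.union_sdiff_of_subset hF] at this
      by_cases hB : F \ negIndex w c ∈ degreeComplex w c Δ
      · rw [h _ hB, mul_zero, zero_smul, Pi.zero_apply]
      · rw [not_not.1 (mt this.1 hB), smul_zero, Pi.zero_apply]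
    · rw [toCech_apply_of_not_subset _ _ _ _ _ hF, Pi.zero_apply]

/-- The Čech differential is the transpose of the boundary map. -/
lemma cechD_toCech (f : Module.Dual K (Finset ι →₀ K)) :
    cechD (vars K Δ w) (toCech w c K Δ f) = toCech w c K Δ (f ∘ₗ boundary K) := by
  ext F
  rw [cechD_apply]
  set N := negIndex w c with hN
  by_cases hF : N ⊆ F
  · rw [toCech_apply_of_subset _ _ _ _ _ hF, ← hN]
    have hsub : F \ N ⊆ F := Finset.sdiff_subset
    by_cases hneg : negSupport c ⊆ N.map w
    · rw [← Finset.sum_subset hsub]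
      · rw [LinearMap.comp_apply, boundary_single, map_sum, Finset.mul_sum, Finset.sum_smul]
        refine Finset.sum_congr rfl fun j hj => ?_
        have hjN : j ∉ N := (Finset.mem_sdiff.1 hj).2
        have hNj : N ⊆ F.erase j := Finset.subset_erase.2 ⟨hF, hjN⟩
        rw [toCech_apply_of_subset _ _ _ _ _ hNj, cechMap_smul, cechMap_gen _ _ _ _
          ((negSupport_subset_map_iff w c _).2 ⟨hneg, hNj⟩), smul_smul, ← hN,
          Finset.erase_sdiff_comm, one_mul, twist_erase w c K hj, ← hN]
        congr 1
        have h1 : sgn K j F = sgn K j N * sgn K j (F \ N) := by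
          rw [← sgn_union K Finset.disjoint_sdiff, Finset.union_sdiff_of_subset hF]
        have h2 : f (Finsupp.single ((F \ N).erase j) (sgn K j (F \ N))) =
            sgn K j (F \ N) * f (Finsupp.single ((F \ N).erase j) 1) := by
          rw [← smul_eq_mul, ← map_smul, Finsupp.smul_single_one]
        rw [h1, h2]
        ring
      · intro j hj hj'
        have hjN : j ∈ N := by_contra fun h => hj' (Finset.mem_sdiff.2 ⟨hj, h⟩)
        rw [toCech_apply_of_not_subset, map_zero, smul_zero]
        exact fun h => (Finset.mem_erase.1 (h hjN)).1 rfl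
    · have h0 (F : Finset ι) : gen K Δ w F c = 0 := not_not.1 fun h => hneg
        ((negSupport_subset_map_iff w c F).1 ((gen_ne_zero_iff K Δ w F c).1 h).1).1
      rw [h0, smul_zero]
      refine Finset.sum_eq_zero fun j _ => ?_
      change _ • cechMap _ _ (ite _ _ _) = _
      rw [h0, smul_zero, ite_self, map_zero, smul_zero]
  · rw [toCech_apply_of_not_subset _ _ _ _ _ hF]
    refine Finset.sum_eq_zero fun j _ => ?_
    rw [toCech_apply_of_not_subset, map_zero, smul_zero]
    exact fun h => hF (h.trans (F.erase_subset j))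

lemma cechD_cechD_toCech (f : Module.Dual K (Finset ι →₀ K)) :
    cechD (vars K Δ w) (cechD (vars K Δ w) (toCech w c K Δ f)) = 0 := by
  rw [cechD_toCech, cechD_toCech, toCech_eq_zero_iff]
  intro B _
  rw [LinearMap.comp_apply, LinearMap.comp_apply, boundary_boundary, map_zero]

/-- The map `toCech` on the dual of the `k`-chains of `degreeComplex w c Δ`. -/
def dualToCech (k : ℤ) : Module.Dual K (chains K (degreeComplex w c Δ) k) →ₗ[K]
    ∀ F, CechTerm (vars K Δ w) F :=
  toCech w c K Δ ∘ₗ LinearMap.dualMap (chainsProj K _ k)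

lemma dualToCech_apply (k : ℤ) (g : Module.Dual K (chains K (degreeComplex w c Δ) k)) :
    dualToCech w c K Δ k g = toCech w c K Δ (g ∘ₗ chainsProj K _ k) := rfl

lemma dualToCech_injective (k : ℤ) : Function.Injective (dualToCech w c K Δ k) := by
  classical
  rw [injective_iff_map_eq_zero]
  intro g hg
  rw [dualToCech_apply, toCech_eq_zero_iff] at hg
  suffices h : chains K (degreeComplex w c Δ) k ≤ LinearMap.ker (g ∘ₗ chainsProj K _ k) by
    ext ⟨x, hx⟩
    have := h hx
    rwa [LinearMap.mem_ker, LinearMap.comp_apply, chainsProj_of_mem K _ _ hx] at this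
  rw [chains_le_iff]
  exact fun B hB _ => hg B hB

/-- The transpose of the boundary map has the same rank as the boundary map. -/
lemma finrank_range_cechD_dualToCech (k : ℤ) :
    Module.finrank K (LinearMap.range
        ((cechD (vars K Δ w)).restrictScalars K ∘ₗ dualToCech w c K Δ k)) =
      Module.finrank K ((chains K (degreeComplex w c Δ) (k + 1)).map (boundary K)) := by
  classical
  let Λ := degreeComplex w c Δ
  have hle : (chains K Λ (k + 1)).map (boundary K) ≤ chains K Λ k :=
    (map_boundary_le_cycles K Λ k).trans inf_le_left
  have hker : LinearMap.ker ((cechD (vars K Δ w)).restrictScalars K ∘ₗ dualToCech w c K Δ k) =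
      (((chains K Λ (k + 1)).map (boundary K)).submoduleOf (chains K Λ k)).dualAnnihilator := by
    ext g
    rw [LinearMap.mem_ker, LinearMap.comp_apply, LinearMap.restrictScalars_apply, dualToCech_apply,
      cechD_toCech, toCech_eq_zero_iff, Submodule.mem_dualAnnihilator]
    constructor
    · rintro h ⟨x, hx⟩ ⟨y, hy, hyx⟩
      dsimp only [Submodule.subtype_apply] at hyx
      subst hyx
      suffices h' : chains K Λ (k + 1) ≤
          LinearMap.ker ((g ∘ₗ chainsProj K _ k) ∘ₗ boundary K) by
        have := h' hy
        rwa [LinearMap.mem_ker, LinearMap.comp_apply, LinearMap.comp_apply,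
          chainsProj_of_mem K _ _ hx] at this
      rw [chains_le_iff]
      exact fun B hB _ => h B hB
    · intro h B hB
      rw [LinearMap.comp_apply]
      by_cases hk : (B.card : ℤ) = k + 1 + 1
      · have hB' := Submodule.mem_map_of_mem (f := boundary K)
          (single_mem_chains K (Δ := Λ) (k := k + 1) hB hk 1)
        rw [LinearMap.comp_apply, chainsProj_of_mem K _ _ (hle hB')]
        exact h ⟨_, hle hB'⟩ hB'
      · rw [boundary_single, map_sum]
        refine Finset.sum_eq_zero fun v hv => ?_
        rw [LinearMap.comp_apply, chainsProj_single_of_card_ne, map_zero]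
        intro h'
        rw [Finset.card_erase_of_mem hv, Nat.cast_sub (Finset.card_pos.2 ⟨v, hv⟩)] at h'
        push_cast at h'
        omega
  have h1 := LinearMap.finrank_range_add_finrank_ker
    ((cechD (vars K Δ w)).restrictScalars K ∘ₗ dualToCech w c K Δ k)
  have h2 := Subspace.finrank_add_finrank_dualAnnihilator_eq
    (((chains K Λ (k + 1)).map (boundary K)).submoduleOf (chains K Λ k))
  rw [hker, Subspace.dual_finrank_eq] at h1
  change _ = Module.finrank K (chains K Λ k) at h1
  change _ = Module.finrank K ((chains K Λ (k + 1)).map (boundary K))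
  rw [(Submodule.submoduleOfEquivOfLe hle).finrank_eq] at h2
  exact Nat.add_right_cancel (h1.trans h2.symm)

/-- The homogeneous Čech cochains are the images of the linear forms on the chains: the term of `F`
contributes in degree `c` exactly if `F = negIndex w c ∪ B` with a face `B` of `degreeComplex w c Δ`
disjoint from `negIndex w c`. -/
lemma range_dualToCech (t : ℤ) :
    LinearMap.range (dualToCech w c K Δ (t - (negIndex w c).card - 1)) =
      degreeCochains w K Δ c t := by
  classical
  set N := negIndex w c with hN
  set Λ := degreeComplex w c Δ
  have hcard {F : Finset ι} (hF : N ⊆ F) : ((F \ N).card : ℤ) = F.card - N.card := by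
    rw [Finset.card_sdiff_of_subset hF, Nat.cast_sub (Finset.card_le_card hF)]
  apply le_antisymm
  · rintro _ ⟨g, rfl⟩
    refine ⟨toCech_mem_pi w c K Δ _, fun F hF => ?_⟩
    rw [dualToCech_apply]
    by_cases hNF : N ⊆ F
    · rw [toCech_apply_of_subset _ _ _ _ _ hNF, LinearMap.comp_apply, ← hN,
        chainsProj_single_of_card_ne, map_zero, mul_zero, zero_smul]
      rw [hcard hNF]
      omega
    · exact toCech_apply_of_not_subset _ _ _ _ _ hNF
  · rintro x ⟨hx, hxt⟩
    have hx' (F : Finset ι) : ∃ a : K, a • gen K Δ w F c = x F := by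
      have : x F ∈ cechTermDegree K Δ w F c := hx F trivial
      rwa [cechTermDegree_eq_span_gen, Submodule.mem_span_singleton] at this
    choose a ha using hx'
    refine ⟨Finsupp.linearCombination K (fun B => twist w c K B * a (N ∪ B)) ∘ₗ
      Submodule.subtype _, ?_⟩
    ext F
    rw [dualToCech_apply]
    by_cases hNF : N ⊆ F
    · rw [toCech_apply_of_subset _ _ _ _ _ hNF, ← hN, LinearMap.comp_apply]
      have hgen := gen_union_ne_zero_iff w c K Δ (B := F \ N) Finset.disjoint_sdiff
      rw [← hN, Finset.union_sdiff_of_subset hNF] at hgen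
      by_cases hB : F \ N ∈ Λ
      · by_cases hF : (F.card : ℤ) = t
        · rw [chainsProj_of_mem K _ _ (single_mem_chains K hB (by rw [hcard hNF]; omega) 1),
            LinearMap.comp_apply, Submodule.subtype_apply, Finsupp.linearCombination_single,
            one_smul, ← mul_assoc, twist_mul_self, one_mul, Finset.union_sdiff_of_subset hNF, ha]
        · rw [chainsProj_single_of_card_ne, map_zero, mul_zero, zero_smul, hxt F hF]
          rw [hcard hNF]
          omega
      · rw [← ha, not_not.1 (mt hgen.1 hB), smul_zero, smul_zero]
    · rw [toCech_apply_of_not_subset _ _ _ _ _ hNF, ← ha, not_not.1 fun h => hNF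
        ((negSupport_subset_map_iff w c F).1 ((gen_ne_zero_iff K Δ w F c).1 h).1).2, smul_zero]

/-- A homogeneous coboundary is the coboundary of a homogeneous cochain. -/
lemma cechD_map_inf_pi (t : ℤ) :
    ((cechCochains (vars K Δ w) (t - 1)).map (cechD (vars K Δ w))).restrictScalars K ⊓
        Submodule.pi Set.univ (fun F => cechTermDegree K Δ w F c) =
      (degreeCochains w K Δ c (t - 1)).map ((cechD (vars K Δ w)).restrictScalars K) := by
  apply le_antisymm
  · rintro _ ⟨⟨x, hx, rfl⟩, hpi⟩
    refine ⟨fun F => degreeProj K Δ w F c (x F), ⟨fun F _ => degreeProj_mem K Δ w F c _,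
      fun F hF => ?_⟩, ?_⟩
    · dsimp only
      rw [hx F hF, map_zero]
    · ext F
      rw [← degreeProj_of_mem K Δ w F (hpi F trivial), LinearMap.restrictScalars_apply,
        cechD_apply, cechD_apply, map_sum]
      refine Finset.sum_congr rfl fun j _ => ?_
      rw [map_smul, degreeProj_cechMap]
  · rw [← range_dualToCech]
    rintro _ ⟨_, ⟨g, rfl⟩, rfl⟩
    have hg : dualToCech w c K Δ _ g ∈ degreeCochains w K Δ c (t - 1) :=
      range_dualToCech w c K Δ (t - 1) ▸ ⟨g, rfl⟩
    refine ⟨⟨_, hg.2, rfl⟩, ?_⟩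
    rw [dualToCech_apply, LinearMap.restrictScalars_apply, cechD_toCech]
    exact toCech_mem_pi w c K Δ _

instance finiteDimensional_degreeCochains (t : ℤ) :
    FiniteDimensional K (degreeCochains w K Δ c t) := by
  rw [← range_dualToCech]
  infer_instance

instance finiteDimensional_degreeCocycles (t : ℤ) :
    FiniteDimensional K (degreeCocycles w K Δ c t) := by
  have : FiniteDimensional K ((degreeCocycles w K Δ c t).map
      ((cechCocycles (vars K Δ w) t).subtype.restrictScalars K)) := by
    rw [map_degreeCocycles]
    exact Submodule.finiteDimensional_inf_left _ _
  exact Module.Finite.equiv (Submodule.equivMapOfInjective _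
    (subtype_restrictScalars_injective w K Δ t) _).symm

instance finiteDimensional_localCohomologyDegree (t : ℤ) :
    FiniteDimensional K (localCohomologyDegree K Δ w t c) :=
  Module.Finite.map (degreeCocycles w K Δ c t) ((((cechCochains (vars K Δ w) (t - 1)).map
    (cechD (vars K Δ w))).submoduleOf (cechCocycles (vars K Δ w) t)).mkQ.restrictScalars K)

/-- The component of degree `c` of local cohomology is dual to the reduced homology of
`degreeComplex w c Δ`, in degree shifted by the number of negative entries of `c`. -/
theorem finrank_localCohomologyDegree (t : ℤ) :
    Module.finrank K (localCohomologyDegree K Δ w t c) =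
      Module.finrank K (ReducedHomology K (degreeComplex w c Δ)
        (t - (negIndex w c).card - 1)) := by
  set k := t - (negIndex w c).card - 1 with hk
  set D := (cechD (vars K Δ w)).restrictScalars K with hD
  set B := ((cechCochains (vars K Δ w) (t - 1)).map (cechD (vars K Δ w))).submoduleOf
    (cechCocycles (vars K Δ w) t) with hB
  have hinj := subtype_restrictScalars_injective w K Δ t
  -- The component is the quotient of the homogeneous cocycles by the homogeneous coboundaries.
  have h1 := finrank_map_add_finrank_inf_ker (B.mkQ.restrictScalars K) (degreeCocycles w K Δ c t)
  have hbdry : (degreeCocycles w K Δ c t ⊓ LinearMap.ker (B.mkQ.restrictScalars K)).map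
      ((cechCocycles (vars K Δ w) t).subtype.restrictScalars K) =
      (degreeCochains w K Δ c (t - 1)).map D := by
    rw [← cechD_map_inf_pi]
    ext x
    constructor
    · rintro ⟨x, ⟨hpi, hx⟩, rfl⟩
      refine ⟨?_, hpi⟩
      have : x ∈ B := (Submodule.Quotient.mk_eq_zero B).1 hx
      exact this
    · rintro ⟨hx, hpi⟩
      have hx' := hx
      obtain ⟨y, hy, rfl⟩ := hx'
      refine ⟨⟨_, cechD_mem_cechCochains w K Δ hy, ?_⟩,
        ⟨hpi, (Submodule.Quotient.mk_eq_zero B).2 hx⟩, rfl⟩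
      have h := (cechD_map_inf_pi w c K Δ t).le ⟨hx, hpi⟩
      rw [← range_dualToCech] at h
      obtain ⟨_, ⟨g, rfl⟩, hg⟩ := h
      rw [← hg]
      exact cechD_cechD_toCech w c K Δ _
  have h2 := (Submodule.equivMapOfInjective _ hinj (degreeCocycles w K Δ c t)).finrank_eq
  have h3 := (Submodule.equivMapOfInjective _ hinj
    (degreeCocycles w K Δ c t ⊓ LinearMap.ker (B.mkQ.restrictScalars K))).finrank_eq
  rw [map_degreeCocycles] at h2
  rw [hbdry] at h3
  rw [← hD] at h2
  have h4 := finrank_map_add_finrank_inf_ker D (degreeCochains w K Δ c t)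
  have hr (t : ℤ) : Module.finrank K ((degreeCochains w K Δ c t).map D) = Module.finrank K
      ((chains K (degreeComplex w c Δ) (t - (negIndex w c).card)).map (boundary K)) := by
    rw [← range_dualToCech, ← LinearMap.range_comp, finrank_range_cechD_dualToCech,
      sub_add_cancel]
  have h5 : Module.finrank K (degreeCochains w K Δ c t) =
      Module.finrank K (chains K (degreeComplex w c Δ) k) := by
    rw [← range_dualToCech, LinearMap.finrank_range_of_inj (dualToCech_injective w c K Δ _),
      Subspace.dual_finrank_eq]
  have h6 := finrank_reducedHomology_add K (degreeComplex w c Δ) k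
  rw [hr] at h3 h4
  rw [show t - 1 - ((negIndex w c).card : ℤ) = k by omega] at h3
  rw [show t - ((negIndex w c).card : ℤ) = k + 1 by omega] at h4
  change Module.finrank K ((degreeCocycles w K Δ c t).map (B.mkQ.restrictScalars K)) = _
  omega

end CechDegree

/-! ### The degrees of the fine grading -/

section Degrees

variable {σ : Type*} [Fintype σ] [DecidableEq σ] {ι : Type*} [Fintype ι] [LinearOrder ι]
  (w : ι ↪ σ) (c : σ → ℤ) (Δ : LowerSet (Finset σ))

/-- At an index `j` with `c (w j) > 0` adding `j` does not change the union of `w(F)` with the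
support of `c`, so `degreeComplex w c Δ` is a cone. -/
lemma insert_mem_degreeComplex {j : ι} (hj : 0 < c (w j)) {B : Finset ι}
    (hB : B ∈ degreeComplex w c Δ) : insert j B ∈ degreeComplex w c Δ := by
  obtain ⟨h1, h2, h3⟩ := hB
  refine ⟨h1, Finset.disjoint_insert_right.2 ⟨?_, h2⟩, ?_⟩
  · simp only [negIndex, Finset.mem_filter, Finset.mem_univ, true_and]
    omega
  · rwa [Finset.union_insert, Finset.map_insert, Finset.union_insert, Finset.insert_eq_of_mem]
    refine Finset.mem_union_left _ ?_
    simp only [intSupport, Finset.mem_filter, Finset.mem_univ, true_and]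
    omega

lemma degreeComplex_eq_bot {s : σ} (hs : c s < 0) (h : s ∉ Set.range w) :
    degreeComplex w c Δ = ⊥ := by
  refine le_bot_iff.1 ?_
  rintro B ⟨h1, -⟩
  have : s ∈ negSupport c := by
    simp only [negSupport, Finset.mem_filter, Finset.mem_univ, true_and, hs]
  obtain ⟨j, -, hj⟩ := Finset.mem_map.1 (h1 this)
  exact h ⟨j, hj⟩

end Degrees

section Sum

variable {m n : ℕ} (Δ : LowerSet (Finset (Fin m ⊕ Fin n))) (c : Fin m ⊕ Fin n → ℤ)

lemma intSupport_eq_disjSum : intSupport c =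
    (intSupport (c ∘ Sum.inl)).disjSum (intSupport (c ∘ Sum.inr)) := by
  ext (i | j) <;> simp [intSupport]

/-- In the degrees that vanish on `V`, only the restriction of `Δ` to `W` matters. -/
lemma degreeComplex_inr_of_eq_zero (h : ∀ i, c (Sum.inl i) = 0) :
    degreeComplex Function.Embedding.inr c Δ =
      degreeComplex (Function.Embedding.refl (Fin n)) (c ∘ Sum.inr) (restrictRight Δ) := by
  have hN : negIndex Function.Embedding.inr c =
    negIndex (Function.Embedding.refl (Fin n)) (c ∘ Sum.inr) := rfl
  have h0 : intSupport c = (intSupport (c ∘ Sum.inr)).map Function.Embedding.inr := by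
    ext (i | j) <;> simp [intSupport, h]
  ext B
  refine and_congr ?_ (and_congr Iff.rfl ?_)
  · have h1 : negSupport c ⊆ (negIndex Function.Embedding.inr c).map Function.Embedding.inr := by
      rintro (i | j) hs
      · simp [negSupport, h] at hs
      · simpa [negSupport, negIndex] using hs
    have h2 : negSupport (c ∘ Sum.inr) ⊆ (negIndex (Function.Embedding.refl (Fin n))
        (c ∘ Sum.inr)).map (Function.Embedding.refl (Fin n)) := by
      intro j hs
      simpa [negSupport, negIndex] using hs
    exact iff_of_true h1 h2
  · change _ ↔ Finset.map _ _ ∈ Δ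
    rw [h0, hN]
    simp only [Finset.map_union, Finset.map_refl]

lemma negIndex_inr_eq_intSupport (hW : ∀ j, c (Sum.inr j) ≤ 0) :
    negIndex Function.Embedding.inr c = intSupport (c ∘ Sum.inr) := by
  ext j
  have := hW j
  simp only [negIndex, intSupport, Finset.mem_filter, Finset.mem_univ, true_and,
    Function.comp_apply, Function.Embedding.inr_apply]
  omega

/-- In the degrees that are nonnegative on `V` and nonpositive on `W`, the complex is a link. -/
lemma degreeComplex_inr_eq_link (hV : ∀ i, 0 ≤ c (Sum.inl i)) (hW : ∀ j, c (Sum.inr j) ≤ 0) :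
    degreeComplex Function.Embedding.inr c Δ = restrictRight
      (link Δ ((intSupport (c ∘ Sum.inl)).disjSum (intSupport (c ∘ Sum.inr)))) := by
  have hN := negIndex_inr_eq_intSupport c hW
  have h1 : negSupport c ⊆ (negIndex Function.Embedding.inr c).map Function.Embedding.inr := by
    rintro (i | j) hs
    · have := hV i
      simp only [negSupport, Finset.mem_filter, Finset.mem_univ, true_and] at hs
      omega
    · simpa [negSupport, negIndex] using hs
  rw [← intSupport_eq_disjSum]
  have h2 : (intSupport (c ∘ Sum.inr)).map Function.Embedding.inr ⊆ intSupport c := by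
    intro s hs
    obtain ⟨j, hj, rfl⟩ := Finset.mem_map.1 hs
    simpa [intSupport] using hj
  ext B
  refine (and_iff_right h1).trans (and_comm.trans (and_congr ?_ ?_))
  · rw [hN, Finset.map_union, ← Finset.union_assoc, Finset.union_eq_left.2 h2]
  · rw [hN]
    simp only [Finset.disjoint_left, intSupport]
    constructor
    · intro h s hs hs'
      obtain ⟨j, hj, rfl⟩ := Finset.mem_map.1 hs'
      exact h (by simpa using hs) hj
    · intro h j hj hj'
      exact h (a := Sum.inr j) (by simpa using hj)
        (Finset.mem_map_of_mem Function.Embedding.inr hj')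

lemma restrictRight_link_eq_bot {G : Finset (Fin m)} {F : Finset (Fin n)}
    (hF : F ∉ restrictRight Δ) : restrictRight (link Δ (G.disjSum F)) = ⊥ := by
  refine le_bot_iff.1 ?_
  rintro B ⟨h, -⟩
  refine hF (Δ.lower ?_ h)
  intro s hs
  obtain ⟨j, hj, rfl⟩ := Finset.mem_map.1 hs
  exact Finset.mem_union_left _ (by simpa using hj)

end Sum

/-! ### Geometric series -/

section Series

variable {m n : ℕ}

lemma coeff_X_mul' {τ : Type*} [DecidableEq τ] (k : τ) (d : τ →₀ ℕ) (f : MvPowerSeries τ ℚ) :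
    MvPowerSeries.coeff d (MvPowerSeries.X k * f) =
      if d k = 0 then 0 else MvPowerSeries.coeff (d - Finsupp.single k 1) f := by
  rw [MvPowerSeries.X, MvPowerSeries.coeff_monomial_mul, one_mul]
  have : Finsupp.single k 1 ≤ d ↔ ¬ d k = 0 := by
    rw [Finsupp.single_le_iff]; omega
  by_cases h : d k = 0
  · rw [if_pos h, if_neg (by simpa [this] using h)]
  · rw [if_neg h, if_pos (this.2 h)]

/-- The product of the series `X k / (1 - X k)`, `k ∈ T`, is the sum of all monomials whose support
is `T`. -/
lemma coeff_prod_geom (T : Finset (Fin m ⊕ Fin n)) (d : Fin m ⊕ Fin n →₀ ℕ) :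
    MvPowerSeries.coeff d (∏ k ∈ T, geom k) = if d.support = T then 1 else 0 := by
  suffices h : ∏ k ∈ T, geom k =
      (fun d => if d.support = T then 1 else 0 : MvPowerSeries (Fin m ⊕ Fin n) ℚ) by
    rw [h]
    rfl
  induction T using Finset.induction_on with
  | empty =>
    ext d
    rw [Finset.prod_empty, MvPowerSeries.coeff_one]
    change _ = if d.support = ∅ then (1 : ℚ) else 0
    simp only [Finsupp.support_eq_empty]
  | insert k T hk ih =>
    rw [Finset.prod_insert hk, ih, geom]
    set f : MvPowerSeries (Fin m ⊕ Fin n) ℚ := fun d => if d.support = T then 1 else 0 with hf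
    set g : MvPowerSeries (Fin m ⊕ Fin n) ℚ :=
      fun d => if d.support = insert k T then 1 else 0 with hg
    have hfc (d) : MvPowerSeries.coeff d f = if d.support = T then 1 else 0 := rfl
    have hgc (d) : MvPowerSeries.coeff d g = if d.support = insert k T then 1 else 0 := rfl
    have hu : (1 - MvPowerSeries.X k : MvPowerSeries (Fin m ⊕ Fin n) ℚ) *
        (1 - MvPowerSeries.X k)⁻¹ = 1 := MvPowerSeries.mul_inv_cancel _ (by simp)
    suffices h : MvPowerSeries.X k * f = (1 - MvPowerSeries.X k) * g by
      rw [mul_right_comm, h, mul_right_comm, hu, one_mul]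
    ext d
    rw [sub_mul, one_mul, map_sub, coeff_X_mul', coeff_X_mul', hfc, hgc, hgc]
    by_cases h0 : d k = 0
    · rw [if_pos h0, if_pos h0, if_neg, sub_zero]
      intro h
      have : k ∈ d.support := h ▸ Finset.mem_insert_self k T
      exact Finsupp.mem_support_iff.1 this h0
    · rw [if_neg h0, if_neg h0]
      have hd : k ∈ d.support := Finsupp.mem_support_iff.2 h0
      by_cases h1 : d k = 1
      · have hs : (d - Finsupp.single k 1).support = d.support.erase k := by
          ext s
          by_cases hs : s = k
          · subst hs; simp [h1]
          · simp [hs]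
        have e1 : d.support.erase k = T ↔ d.support = insert k T := by
          constructor
          · intro h; rw [← h, Finset.insert_erase hd]
          · intro h; rw [h, Finset.erase_insert hk]
        have e2 : d.support.erase k ≠ insert k T := fun h =>
          Finset.notMem_erase k d.support (h ▸ Finset.mem_insert_self k T)
        rw [hs, if_neg e2, sub_zero]
        simp only [e1]
      · have hs : (d - Finsupp.single k 1).support = d.support := by
          ext s
          by_cases hs : s = k
          · subst hs; simp; omega
          · simp [Ne.symm hs]
        rw [hs, sub_self, if_neg]
        rintro rfl
        exact hk hd

/-! ### The Hilbert series -/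

variable (K : Type*) [Field K] (Δ : LowerSet (Finset (Fin m ⊕ Fin n))) (i : ℕ)

lemma linkDim_eq_zero {F : Finset (Fin n)} (hF : F ∉ restrictRight Δ) (G : Finset (Fin m)) :
    linkDim K Δ i F G = 0 := by
  rw [linkDim, restrictRight_link_eq_bot Δ hF, finrank_reducedHomology_bot]

/-- The coefficients of the second summand of the Hilbert series: only the supports of the two parts
of the degree contribute. -/
lemma expand_apply (c : Fin m ⊕ Fin n → ℤ) :
    expand (∑ F ∈ faces (restrictRight Δ), ∑ G : Finset (Fin m) with G.Nonempty,
        (linkDim K Δ i F G : MvPowerSeries (Fin m ⊕ Fin n) ℚ) *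
          ((∏ v ∈ G, geom (Sum.inl v)) * ∏ w ∈ F, geom (Sum.inr w))) c =
      if (∀ i, 0 ≤ c (Sum.inl i)) ∧ ∀ j, c (Sum.inr j) ≤ 0 then
        if (intSupport (c ∘ Sum.inl)).Nonempty then
          (linkDim K Δ i (intSupport (c ∘ Sum.inr)) (intSupport (c ∘ Sum.inl)) : ℚ) else 0
      else 0 := by
  rw [expand]
  refine if_congr Iff.rfl ?_ rfl
  set d : Fin m ⊕ Fin n →₀ ℕ := Finsupp.equivFunOnFinite.symm fun k => (c k).natAbs with hd
  have hsupp : d.support = (intSupport (c ∘ Sum.inl)).disjSum (intSupport (c ∘ Sum.inr)) := by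
    rw [← intSupport_eq_disjSum]
    ext k
    simp [hd, intSupport]
  have hterm (F : Finset (Fin n)) (G : Finset (Fin m)) : MvPowerSeries.coeff d
      ((linkDim K Δ i F G : MvPowerSeries (Fin m ⊕ Fin n) ℚ) *
          ((∏ v ∈ G, geom (Sum.inl v)) * ∏ w ∈ F, geom (Sum.inr w))) =
      if intSupport (c ∘ Sum.inl) = G ∧ intSupport (c ∘ Sum.inr) = F then
        (linkDim K Δ i F G : ℚ) else 0 := by
    have hinj : (intSupport (c ∘ Sum.inl)).disjSum (intSupport (c ∘ Sum.inr)) = G.disjSum F ↔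
        intSupport (c ∘ Sum.inl) = G ∧ intSupport (c ∘ Sum.inr) = F := by
      constructor
      · intro h
        exact ⟨by simpa using congrArg Finset.toLeft h, by simpa using congrArg Finset.toRight h⟩
      · rintro ⟨rfl, rfl⟩
        rfl
    rw [← Finset.prod_disjSum, ← nsmul_eq_mul, map_nsmul, coeff_prod_geom, hsupp, nsmul_eq_mul]
    simp only [hinj, mul_ite, mul_one, mul_zero]
  simp only [map_sum, hterm]
  by_cases hG : (intSupport (c ∘ Sum.inl)).Nonempty
  · rw [if_pos hG]
    by_cases hF : intSupport (c ∘ Sum.inr) ∈ restrictRight Δ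
    · rw [Finset.sum_eq_single_of_mem (intSupport (c ∘ Sum.inr)),
        Finset.sum_eq_single_of_mem (intSupport (c ∘ Sum.inl)), if_pos ⟨rfl, rfl⟩]
      · simpa using hG
      · intro G _ h
        rw [if_neg fun h' => h h'.1.symm]
      · simpa [faces] using hF
      · intro F _ h
        exact Finset.sum_eq_zero fun G _ => if_neg fun h' => h h'.2.symm
    · rw [linkDim_eq_zero K Δ i hF, Nat.cast_zero]
      refine Finset.sum_eq_zero fun F hF' => Finset.sum_eq_zero fun G _ => if_neg ?_
      rintro ⟨-, rfl⟩
      exact hF (by simpa [faces] using hF')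
  · rw [if_neg hG]
    refine Finset.sum_eq_zero fun F _ => Finset.sum_eq_zero fun G hG' => if_neg ?_
    rintro ⟨rfl, -⟩
    exact hG (by simpa using hG')

end Series

end

end StanleyReisner

open StanleyReisner in
theorem mainTheorem9 (K : Type*) [Field K] (m n : ℕ)
    (Δ : LowerSet (Finset (Fin m ⊕ Fin n))) (i : ℕ) :
    (∀ c, FiniteDimensional K (localCohomologyDegree K Δ Function.Embedding.inr i c)) ∧
    (∀ b, FiniteDimensional K
      (localCohomologyDegree K (restrictRight Δ) (Function.Embedding.refl (Fin n)) i b)) ∧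
    hilbertSeries K Δ Function.Embedding.inr i =
      ofT m (hilbertSeries K (restrictRight Δ) (Function.Embedding.refl (Fin n)) i) +
      expand (∑ F ∈ faces (restrictRight Δ), ∑ G : Finset (Fin m) with G.Nonempty,
        (linkDim K Δ i F G : MvPowerSeries (Fin m ⊕ Fin n) ℚ) *
          ((∏ v ∈ G, geom (Sum.inl v)) * ∏ w ∈ F, geom (Sum.inr w))) := by
  refine ⟨fun c => inferInstance, fun b => inferInstance, ?_⟩
  funext c
  rw [Pi.add_apply, expand_apply, ofT, hilbertSeries, finrank_localCohomologyDegree]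
  by_cases h0 : ∀ i, c (Sum.inl i) = 0
  · have hG : ¬ (intSupport (c ∘ Sum.inl)).Nonempty := by
      simp [intSupport, h0]
    rw [if_pos h0, if_neg hG, ite_self, add_zero, hilbertSeries, finrank_localCohomologyDegree,
      degreeComplex_inr_of_eq_zero Δ c h0]
    rfl
  · have hG : (intSupport (c ∘ Sum.inl)).Nonempty := by
      obtain ⟨k, hk⟩ := not_forall.1 h0
      exact ⟨k, by simpa [intSupport] using hk⟩
    rw [if_neg h0, if_pos hG, zero_add]
    split_ifs with h
    · rw [degreeComplex_inr_eq_link Δ c h.1 h.2, negIndex_inr_eq_intSupport c h.2, linkDim]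
    · rw [Nat.cast_eq_zero]
      by_cases hV : ∀ i, 0 ≤ c (Sum.inl i)
      · obtain ⟨j, hj⟩ := not_forall.1 fun hW => h ⟨hV, hW⟩
        exact finrank_reducedHomology_eq_zero_of_cone K j
          (fun B hB => insert_mem_degreeComplex _ c Δ (not_le.1 hj) hB) _
      · obtain ⟨k, hk⟩ := not_forall.1 hV
        rw [degreeComplex_eq_bot _ c Δ (not_le.1 hk) (by simp), finrank_reducedHomology_bot]
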